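/- Let $R$ be a commutative ring, and let $B(R)$ be the Boolean ring of idempotents of $R$ (with the multiplication of $R$ and with addition $e\oplus f=e+f-2ef$). For $x\in\operatorname{Spec}B(R)$ the Pierce stalk of $R$ at $x$ is the ring $R_x=R/xR$. Assume that every Pierce stalk $R_x$ is projective free, i.e. every finitely generated projective $R_x$-module is free. Let $n\ge 2$ and let $h\in R[t]$ be a monic polynomial of degree $n$. Then the following are equivalent: (1) every $A\in M_n(R)$ with characteristic polynomial $h$ is strongly clean; (2) the companion matrix $C_h\in M_n(R)$ of $h$ is strongly clean; (3) $h$ has a gSRC-factorization in $R[t]$. Here an element $a$ of a ring is strongly clean if $a=e+u$ with $e$ idempotent, $u$ a unit and $eu=ue$. For a commutative ring $S$, an SRC-factorization of a monic polynomial $f\in S[t]$ is a factorization $f=f_0f_1$ in $S[t]$ such that $f_0(0)$ and $f_1(1)$ are units of $S$ and the ideal $(f_0,f_1)$ equals $S[t]$. The polynomial $h$ has a gSRC-factorization if there are finitely many pairwise orthogonal idempotents $e_1,\dots,e_k\in R$ with $e_1+\dots+e_k=1$ such that, for each $i$, $he_i$ has an SRC-factorization in $e_iR[t]$, where $e_iR$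 is regarded as a ring with identity $e_i$. -/

import Mathlib

open scoped Polynomial

universe u

namespace PierceClean

/-- An element of a ring is strongly clean if it is the sum of an idempotent and a unit that
commute with each other. -/
def IsStronglyClean {S : Type*} [Ring S] (a : S) : Prop :=
  ∃ e w : S, IsIdempotentElem e ∧ IsUnit w ∧ e * w = w * e ∧ a = e + w

/-- A commutative ring is projective free if all its finitely generated projective modules
are free. -/
def IsProjectiveFree (S : Type u) [CommRing S] : Prop :=
  ∀ (P : Type u) [AddCommGroup P] [Module S P] [Module.Finite S P] [Module.Projective S P],
    Module.Free S P

/-- The boolean ring of idempotents of a commutative ring: the product is that of `R`, the sum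
of `e` and `f` is the symmetric difference `e + f - 2ef`. -/
abbrev IdemRing (R : Type u) [CommRing R] : Type u :=
  AsBoolRing {e : R // IsIdempotentElem e}

/-- The underlying element of `R` of an idempotent of `R`. -/
def IdemRing.val {R : Type u} [CommRing R] (e : IdemRing R) : R :=
  (ofBoolRing e : {e : R // IsIdempotentElem e}).1

/-- The points of the base space of the Pierce sheaf of `R`: the spectrum of the boolean ring
of idempotents of `R`. -/
abbrev PierceSpectrum (R : Type u) [CommRing R] : Type u :=
  PrimeSpectrum (IdemRing R)

/-- For a prime ideal `x` of the boolean ring of idempotents of `R`, the ideal `xR` of `R`. -/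
def PierceSpectrum.ideal {R : Type u} [CommRing R] (x : PierceSpectrum R) : Ideal R :=
  Ideal.span (IdemRing.val '' (x.asIdeal : Set (IdemRing R)))

/-- The stalk `R / xR` of the Pierce sheaf of `R` at `x`. -/
abbrev PierceStalk {R : Type u} [CommRing R] (x : PierceSpectrum R) : Type u :=
  R ⧸ x.ideal

/-- The companion matrix of a monic polynomial `h` of degree `n`: it has `1` below the diagonal,
the last column is `-h₀, …, -hₙ₋₁`, and all other entries vanish. -/
def companionMatrix {R : Type*} [CommRing R] (n : ℕ) (h : R[X]) : Matrix (Fin n) (Fin n) R :=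
  Matrix.of fun i j =>
    if (j : ℕ) + 1 = n then -h.coeff i else if (i : ℕ) = (j : ℕ) + 1 then 1 else 0

/-- The polynomial `h` has an SRC-factorization: `h = f₀ f₁` where `f₀(0)` and `f₁(1)` are units
and `f₀`, `f₁` generate the unit ideal of `S[X]`. -/
def HasSRCFactorization {S : Type*} [CommRing S] (h : S[X]) : Prop :=
  ∃ f₀ f₁ : S[X], h = f₀ * f₁ ∧ IsUnit (f₀.eval 0) ∧ IsUnit (f₁.eval 1) ∧
    Ideal.span {f₀, f₁} = (⊤ : Ideal S[X])

/-- For an idempotent `e` of a commutative ring `R`, the ring homomorphism `r ↦ re` from `R` to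
the ring `eR`, whose identity element is `e`. -/
def toCorner {R : Type*} [CommRing R] {e : R} (he : IsIdempotentElem e) : R →+* he.Corner where
  toFun r := ⟨e * r * e, r, rfl⟩
  map_one' := Subtype.ext (by
    change e * 1 * e = e
    rw [mul_one, he.eq])
  map_mul' r s := Subtype.ext (by
    change e * (r * s) * e = (e * r * e) * (e * s * e)
    linear_combination (-e * r * s * e - r * s * e) * he.eq)
  map_zero' := Subtype.ext (by
    change e * 0 * e = 0
    ring)
  map_add' r s := Subtype.ext (by
    change e * (r + s) * e = e * r * e + e * s * e
    ring)

/-- The polynomial `h` has a gSRC-factorization: for some (finite) complete orthogonal set of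
idempotents `e₁, …, eₖ` of `R`, each `h eᵢ` has an SRC-factorization over the ring `eᵢR`. -/
def HasGSRCFactorization {R : Type*} [CommRing R] (h : R[X]) : Prop :=
  ∃ (k : ℕ) (e : Fin k → R) (he : CompleteOrthogonalIdempotents e),
    ∀ i : Fin k, HasSRCFactorization (h.map (toCorner (he.idem i)))

end PierceClean

/-! A strongly clean decomposition `A = E + W` splits the module into the kernel of `E`, where `A =
W` is invertible, and its image, where `1 - A = -W` is. The two characteristic polynomials are `f₀`
and `f₁`; for a companion matrix they are comaximal, because over a residue field each eigenspace is
at most a line (`det_ne_zero_or_det_ne_zero`). Conversely, Cayley–Hamilton and a Chinese remainder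
computation modulo `f₀ f₁` give `E` and the inverse of `W` as polynomials in `A`. As `R` is the
product of the rings `eᵢR`, gSRC-factorizations glue to SRC ones. -/

namespace PierceClean

open Polynomial Matrix

/-! ### Strong cleanness from factorizations, and gluing along idempotents -/

section SRCFactorization

/-- An element of an algebra that is a root of a polynomial with an SRC-factorization is
strongly clean. -/
theorem HasSRCFactorization.isStronglyClean {R B : Type*} [CommRing R] [Ring B] [Algebra R B]
    {h : R[X]} (hh : HasSRCFactorization h) {A : B} (hA : aeval A h = 0) :
    IsStronglyClean A := by
  obtain ⟨f₀, f₁, rfl, h₀, h₁, htop⟩ := hh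
  obtain ⟨a, b, hab⟩ := Ideal.mem_span_pair.1 ((Ideal.eq_top_iff_one _).1 htop)
  obtain ⟨d₀, hd₀⟩ := h₀.exists_right_inv
  obtain ⟨d₁, hd₁⟩ := h₁.exists_right_inv
  obtain ⟨q₀, hq₀⟩ := X_sub_C_dvd_sub_C_eval (a := (0 : R)) (p := f₀)
  obtain ⟨q₁, hq₁⟩ := X_sub_C_dvd_sub_C_eval (a := (1 : R)) (p := f₁)
  have hd₀' : C (f₀.eval 0) * C d₀ = 1 := by rw [← C_mul, hd₀, C_1]
  have hd₁' : C (f₁.eval 1) * C d₁ = 1 := by rw [← C_mul, hd₁, C_1]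
  rw [C_0, sub_zero] at hq₀
  rw [C_1] at hq₁
  -- The inverse of `X - a * f₀` modulo `f₀ f₁`: this element is `X` modulo `f₀` and `X - 1` modulo
  -- `f₁`, with inverses `-q₀ d₀` and `-q₁ d₁` there; `b * f₁` and `a * f₀` combine them.
  set u : R[X] := -(q₀ * C d₀ * (b * f₁)) - q₁ * C d₁ * (a * f₀) with hu
  have key : ∀ p : R[X], f₀ * f₁ ∣ p → aeval A p = 0 := by
    rintro _ ⟨q, rfl⟩
    rw [map_mul, hA, zero_mul]
  have hunit : aeval A ((X - a * f₀) * u - 1) = 0 := by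
    refine key _ (IsCoprime.mul_dvd ⟨a, b, hab⟩ ?_ ?_)
    · refine ⟨-a * u - X * q₁ * C d₁ * a - (b * f₁) * C d₀ - a, ?_⟩
      rw [hu]
      linear_combination (b * f₁) * C d₀ * hq₀ + (b * f₁) * hd₀' + hab
    · refine ⟨b * u - (X - 1) * q₀ * C d₀ * b - (a * f₀) * C d₁ - b, ?_⟩
      rw [hu]
      linear_combination (a * f₀) * C d₁ * hq₁ + (a * f₀) * hd₁' + hab -
        (-(q₀ * C d₀ * (b * f₁)) - q₁ * C d₁ * (a * f₀)) * hab
  have hidem : aeval A ((a * f₀) * (a * f₀) - a * f₀) = 0 :=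
    key _ ⟨-(a * b), by linear_combination (a * f₀) * hab⟩
  rw [map_sub, sub_eq_zero] at hunit hidem
  refine ⟨aeval A (a * f₀), aeval A (X - a * f₀), ?_, ?_, ?_, ?_⟩
  · rw [IsIdempotentElem, ← map_mul, hidem]
  · refine ⟨⟨_, aeval A u, ?_, ?_⟩, rfl⟩
    · rw [← map_mul, hunit, map_one]
    · rw [← map_mul, mul_comm, hunit, map_one]
  · rw [← map_mul, ← map_mul, mul_comm]
  · rw [← map_add, add_sub_cancel, aeval_X]

/-- SRC-factorizations over the factors of a finite product of rings come from an
SRC-factorization over the product. -/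
theorem hasSRCFactorization_of_bijective {R ι : Type*} [CommRing R] [Finite ι] {S : ι → Type*}
    [∀ i, CommRing (S i)] (φ : ∀ i, R →+* S i) (hφ : Function.Bijective (RingHom.pi φ))
    {h : R[X]} (hh : ∀ i, HasSRCFactorization (h.map (φ i))) : HasSRCFactorization h := by
  have inj : ∀ r s : R, (∀ i, φ i r = φ i s) → r = s := fun r s hrs => hφ.1 (funext hrs)
  have surj : ∀ s : ∀ i, S i, ∃ r : R, ∀ i, φ i r = s i := fun s =>
    (hφ.2 s).imp fun r hr i => congrFun hr i
  have injp : ∀ p q : R[X], (∀ i, p.map (φ i) = q.map (φ i)) → p = q := fun p q hpq => by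
    ext m
    refine inj _ _ fun i => ?_
    rw [← coeff_map, ← coeff_map, hpq i]
  have surjp : ∀ s : ∀ i, (S i)[X], ∃ p : R[X], ∀ i, p.map (φ i) = s i := fun s => by
    cases nonempty_fintype ι
    choose r hr using fun m => surj fun i => (s i).coeff m
    refine ⟨∑ m ∈ Finset.range (Finset.univ.sup fun i => (s i).natDegree + 1), monomial m (r m),
      fun i => ?_⟩
    rw [Polynomial.map_sum]
    simp only [map_monomial, hr]
    refine ((s i).as_sum_range' _ ?_).symm
    exact Nat.lt_of_succ_le (Finset.le_sup (f := fun i => (s i).natDegree + 1) (Finset.mem_univ i))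
  choose f₀ f₁ hf h₀ h₁ htop using hh
  choose a b hab using fun i => Ideal.mem_span_pair.1 ((Ideal.eq_top_iff_one _).1 (htop i))
  choose d₀ hd₀ using fun i => (h₀ i).exists_right_inv
  choose d₁ hd₁ using fun i => (h₁ i).exists_right_inv
  obtain ⟨F₀, hF₀⟩ := surjp f₀
  obtain ⟨F₁, hF₁⟩ := surjp f₁
  obtain ⟨P, hP⟩ := surjp a
  obtain ⟨Q, hQ⟩ := surjp b
  obtain ⟨D₀, hD₀⟩ := surj d₀
  obtain ⟨D₁, hD₁⟩ := surj d₁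
  refine ⟨F₀, F₁, injp _ _ fun i => ?_, IsUnit.of_mul_eq_one D₀ (inj _ _ fun i => ?_),
    IsUnit.of_mul_eq_one D₁ (inj _ _ fun i => ?_),
    (Ideal.eq_top_iff_one _).2 (Ideal.mem_span_pair.2 ⟨P, Q, injp _ _ fun i => ?_⟩)⟩
  · rw [Polynomial.map_mul, hF₀, hF₁, hf]
  · rw [map_mul, map_one, hD₀, ← hd₀, ← hF₀, ← map_zero (φ i), eval_map_apply]
  · rw [map_mul, map_one, hD₁, ← hd₁, ← hF₁, ← map_one (φ i), eval_map_apply]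
  · rw [Polynomial.map_add, Polynomial.map_mul, Polynomial.map_mul, hP, hQ, hF₀, hF₁, hab,
      Polynomial.map_one]

theorem toCorner_val {R : Type*} [CommRing R] {e : R} (he : IsIdempotentElem e) (r : R) :
    (toCorner he r).1 = e * r := by
  change e * r * e = e * r
  linear_combination r * he.eq

theorem bijective_pi_toCorner {R ι : Type*} [CommRing R] [Fintype ι] {e : ι → R}
    (he : CompleteOrthogonalIdempotents e) :
    Function.Bijective (RingHom.pi fun i => toCorner (he.idem i)) := by
  classical
  refine ⟨fun r s hrs => ?_, fun s => ?_⟩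
  · have (i : ι) : e i * r = e i * s := by
      rw [← toCorner_val (he.idem i), ← toCorner_val (he.idem i)]
      exact congrArg Subtype.val (congrFun hrs i)
    rw [← one_mul r, ← one_mul s, ← he.complete, Finset.sum_mul, Finset.sum_mul]
    exact Finset.sum_congr rfl fun i _ => this i
  · refine ⟨∑ i, (s i).1, funext fun i => Subtype.ext ?_⟩
    have mul_val (i j : ι) : e i * (s j).1 = if j = i then (s i).1 else 0 := by
      obtain ⟨r, hr⟩ := (s j).2
      split_ifs with hij
      · subst hij
        rw [← hr]
        linear_combination r * e j * (he.idem j).eq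
      · rw [← hr]
        linear_combination r * e j * he.ortho (Ne.symm hij)
    refine (toCorner_val (he.idem i) _).trans ?_
    simp only [Finset.mul_sum, mul_val, Finset.sum_ite_eq', Finset.mem_univ, if_true]

/-- A gSRC-factorization can be glued to an SRC-factorization. -/
theorem HasGSRCFactorization.hasSRCFactorization {R : Type*} [CommRing R] {h : R[X]}
    (hh : HasGSRCFactorization h) : HasSRCFactorization h := by
  obtain ⟨k, e, he, hsrc⟩ := hh
  exact hasSRCFactorization_of_bijective _ (bijective_pi_toCorner he) hsrc

theorem HasSRCFactorization.map {R S : Type*} [CommRing R] [CommRing S] (φ : R →+* S) {h : R[X]}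
    (hh : HasSRCFactorization h) : HasSRCFactorization (h.map φ) := by
  obtain ⟨f₀, f₁, rfl, h₀, h₁, htop⟩ := hh
  refine ⟨f₀.map φ, f₁.map φ, Polynomial.map_mul φ, ?_, ?_, ?_⟩
  · rw [← map_zero φ, eval_map_apply]
    exact h₀.map φ
  · rw [← map_one φ, eval_map_apply]
    exact h₁.map φ
  · have := congrArg (Ideal.map (mapRingHom φ)) htop
    rwa [Ideal.map_span, Ideal.map_top, Set.image_pair] at this

theorem HasSRCFactorization.hasGSRCFactorization {R : Type*} [CommRing R] {h : R[X]}
    (hh : HasSRCFactorization h) : HasGSRCFactorization h :=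
  ⟨1, fun _ => 1,
    ⟨⟨fun _ => IsIdempotentElem.one, fun i j hij => (hij (Subsingleton.elim i j)).elim⟩, by simp⟩,
    fun _ => hh.map _⟩

end SRCFactorization

/-! ### Companion matrices and the factorization they force -/

section Companion

variable {R : Type*} [CommRing R] {n : ℕ}

/-- The row vector `(1, X, …, X ^ (n - 1))` is an eigenvector of the companion matrix modulo
`h`. -/
theorem vecMul_charmatrix_companionMatrix {h : R[X]} (hmonic : h.Monic) (hdeg : h.natDegree = n) :
    (fun i : Fin n => (X : R[X]) ^ (i : ℕ)) ᵥ* (companionMatrix n h).charmatrix =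
      fun j : Fin n => if (j : ℕ) + 1 = n then h else 0 := by
  funext j
  have hX : ∑ i : Fin n, X ^ (i : ℕ) * (Matrix.scalar (Fin n) (X : R[X])) i j =
      X ^ ((j : ℕ) + 1) := by
    simp [Matrix.diagonal_apply, pow_succ]
  simp only [Matrix.vecMul, dotProduct, charmatrix, Matrix.sub_apply, mul_sub,
    Finset.sum_sub_distrib, hX, RingHom.mapMatrix_apply, Matrix.map_apply, companionMatrix,
    Matrix.of_apply]
  split_ifs with hj
  · conv_rhs => rw [hmonic.as_sum, hdeg, Finset.sum_range]
    simp only [hj, map_neg, mul_neg, Finset.sum_neg_distrib, sub_neg_eq_add, mul_comm]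
  · have hlt : (j : ℕ) + 1 < n := lt_of_le_of_ne j.2 hj
    rw [Finset.sum_eq_single ⟨(j : ℕ) + 1, hlt⟩] <;> simp +contextual [Fin.ext_iff]

/-- Multiplying the eigenvector relation by the adjugate, entry `0` shows that `h` divides the
characteristic polynomial; both are monic of degree `n`. -/
theorem charpoly_companionMatrix [Nontrivial R] (hn : 0 < n) {h : R[X]} (hmonic : h.Monic)
    (hdeg : h.natDegree = n) : (companionMatrix n h).charpoly = h := by
  refine eq_of_monic_of_dvd_of_natDegree_le hmonic (charpoly_monic _) ?_ ?_
  · have hv := congrArg (fun v => (v ᵥ* (companionMatrix n h).charmatrix.adjugate) ⟨0, hn⟩)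
      (vecMul_charmatrix_companionMatrix hmonic hdeg)
    simp only [Matrix.vecMul_vecMul, Matrix.mul_adjugate, Matrix.vecMul_smul, Matrix.vecMul_one,
      Pi.smul_apply, pow_zero, smul_eq_mul, mul_one] at hv
    rw [Matrix.charpoly, hv]
    simp only [Matrix.vecMul, dotProduct]
    refine Finset.dvd_sum fun j _ => ?_
    split_ifs
    · exact dvd_mul_right _ _
    · simp
  · rw [charpoly_natDegree_eq_dim, Fintype.card_fin, hdeg]

/-- Each column but the last says `v (j + 1) = c * v j`. -/
theorem apply_eq_of_vecMul_companionMatrix {K : Type*} [CommRing K] (hn : 0 < n) {h : R[X]}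
    (ψ : R →+* K) {v : Fin n → K} {c : K}
    (hv : v ᵥ* (companionMatrix n h).map ψ = c • v) (i : Fin n) :
    v i = c ^ (i : ℕ) * v ⟨0, hn⟩ := by
  obtain ⟨i, hi⟩ := i
  induction i with
  | zero => simp
  | succ j ih =>
    have hj := congrFun hv ⟨j, (Nat.lt_succ_self j).trans hi⟩
    have hne : j + 1 ≠ n := hi.ne
    simp only [Matrix.vecMul, dotProduct, companionMatrix, Matrix.map_apply, Matrix.of_apply,
      if_neg hne, Pi.smul_apply, smul_eq_mul, ih] at hj
    rw [Finset.sum_eq_single ⟨j + 1, hi⟩ (by simp +contextual [Fin.ext_iff]) (by simp)] at hj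
    simp only [if_true, map_one, mul_one] at hj
    rw [hj]
    ring

/-- Over a field, a companion matrix has at most one eigenline for each eigenvalue, so that it
cannot meet both the kernel and the image of a commuting idempotent. -/
theorem det_ne_zero_or_det_ne_zero {K : Type*} [Field K] (hn : 0 < n) {h : R[X]} (ψ : R →+* K)
    {A E : Matrix (Fin n) (Fin n) K} (hA : A = (companionMatrix n h).map ψ)
    (hE : IsIdempotentElem E) (hc : E * A = A * E) (c : K) :
    (((Matrix.scalar (Fin n) c) - A) * (1 - E) + E).det ≠ 0 ∨
      (((Matrix.scalar (Fin n) c) - A) * E + (1 - E)).det ≠ 0 := by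
  by_contra! hdet
  obtain ⟨hdet₀, hdet₁⟩ := hdet
  rw [← exists_vecMul_eq_zero_iff] at hdet₀ hdet₁
  obtain ⟨v, hv, hv₀⟩ := hdet₀
  obtain ⟨w, hw, hw₀⟩ := hdet₁
  set T := Matrix.scalar (Fin n) c - A with hT
  have hTE : T * E = E * T := by
    rw [hT, sub_mul, mul_sub, hc, (Matrix.scalar_commute c (fun r => mul_comm c r) E).eq]
  have hEE : E * E = E := hE
  -- Multiplying by `E` kills `T * (1 - E)` and keeps `E`.
  have hvE : v ᵥ* E = 0 := by
    have := congrArg (· ᵥ* E) hv₀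
    simpa [Matrix.vecMul_vecMul, add_mul, mul_assoc, sub_mul, hEE] using this
  have hwE : w ᵥ* (1 - E) = 0 := by
    have := congrArg (· ᵥ* (1 - E)) hw₀
    simpa [Matrix.vecMul_vecMul, add_mul, mul_assoc, mul_sub, sub_mul, hEE] using this
  have hvT : v ᵥ* T = 0 := by
    rw [Matrix.vecMul_add, hvE, add_zero, mul_sub, mul_one, hTE, Matrix.vecMul_sub,
      ← Matrix.vecMul_vecMul, hvE, Matrix.zero_vecMul, sub_zero] at hv₀
    exact hv₀
  have hwT : w ᵥ* T = 0 := by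
    rw [Matrix.vecMul_add, hwE, add_zero, hTE, ← Matrix.vecMul_vecMul] at hw₀
    rw [Matrix.vecMul_sub, Matrix.vecMul_one, sub_eq_zero] at hwE
    rwa [← hwE] at hw₀
  have eig : ∀ x : Fin n → K, x ᵥ* T = 0 → x = x ⟨0, hn⟩ • fun i : Fin n => c ^ (i : ℕ) := by
    intro x hx
    rw [hT, Matrix.vecMul_sub, sub_eq_zero, hA] at hx
    have hx' : x ᵥ* (companionMatrix n h).map ψ = c • x := by
      rw [← hx]
      funext i
      simp [mul_comm]
    funext i
    rw [Pi.smul_apply, smul_eq_mul, mul_comm]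
    exact apply_eq_of_vecMul_companionMatrix hn ψ hx' i
  set p : Fin n → K := fun i => c ^ (i : ℕ)
  have cancel : ∀ (x : Fin n → K) (M : Matrix (Fin n) (Fin n) K), x ≠ 0 → x ᵥ* T = 0 →
      x ᵥ* M = 0 → p ᵥ* M = 0 := by
    intro x M hx hxT hxM
    rw [eig x hxT, Matrix.smul_vecMul] at hxM
    refine (smul_eq_zero.1 hxM).resolve_left fun h0 => hx ?_
    rw [eig x hxT, h0, zero_smul]
  -- `v` and `w` are multiples of `p`, so `p` is killed by both `E` and `1 - E`; yet its entry `0`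
  -- is `1`.
  have hp : p = 0 := by
    have h₁ := cancel w _ hw hwT hwE
    rwa [Matrix.vecMul_sub, cancel v _ hv hvT hvE, Matrix.vecMul_one, sub_zero] at h₁
  have := congrFun hp ⟨0, hn⟩
  simp [p] at this

theorem mul_add_mul_add_eq_one {S : Type*} [Ring S] {E W V : S} (hE : E * E = E)
    (hV : E * V = V * E) (hWV : W * V = 1) :
    (W * E + (1 - E)) * (V * E + (1 - E)) = 1 := by
  have h₁ : W * E * (V * E) = E := by
    rw [mul_assoc, ← mul_assoc E, hV, mul_assoc, hE, ← mul_assoc, hWV, one_mul]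
  have h₂ : E * (V * E) = V * E := by rw [← mul_assoc, hV, mul_assoc, hE]
  have h₃ : W * E * E = W * E := by rw [mul_assoc, hE]
  simp only [add_mul, mul_add, mul_sub, sub_mul, h₁, h₂, h₃, hE, mul_one, one_mul]
  abel

/-- The element acts as `W` on the image of `E` and as the identity on its kernel. -/
theorem isUnit_mul_add_one_sub {S : Type*} [Ring S] {E W V : S} (hE : E * E = E)
    (hW : E * W = W * E) (hV : E * V = V * E) (hWV : W * V = 1) (hVW : V * W = 1) :
    IsUnit (W * E + (1 - E)) :=
  ⟨⟨_, _, mul_add_mul_add_eq_one hE hV hWV, mul_add_mul_add_eq_one hE hW hVW⟩, rfl⟩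

/-- If the companion matrix of `h` is the sum of a commuting idempotent `E` and a unit, then the
characteristic polynomials on the kernel and the image of `E` give an SRC-factorization. -/
theorem hasSRCFactorization_of_isStronglyClean [Nontrivial R] (hn : 0 < n) {h : R[X]}
    (hmonic : h.Monic) (hdeg : h.natDegree = n) (hh : IsStronglyClean (companionMatrix n h)) :
    HasSRCFactorization h := by
  obtain ⟨E, W, hE, ⟨⟨W, V, hWV, hVW⟩, rfl⟩, hEW, hA⟩ := hh
  simp only at hEW hA
  set A := companionMatrix n h with hAdef
  have hEE : E * E = E := hE
  have hcomm : E * A = A * E := by rw [hA, mul_add, add_mul, hEW]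
  have hEV : E * V = V * E := by
    calc E * V = V * W * (E * V) := by rw [hVW, one_mul]
      _ = V * (W * E) * V := by simp only [mul_assoc]
      _ = V * E := by rw [← hEW, mul_assoc, mul_assoc, hWV, mul_one]
  let ι := (C : R →+* R[X]).mapMatrix (m := Fin n)
  let T := Matrix.scalar (Fin n) (X : R[X]) - ι A
  have hιE : ι E * ι E = ι E := by rw [← map_mul, hEE]
  have hTE : T * ι E = ι E * T := by
    rw [sub_mul, mul_sub, ← map_mul, ← map_mul, hcomm,
      (Matrix.scalar_commute (X : R[X]) (fun r => mul_comm _ r) (ι E)).eq]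
  -- Serves both evaluation at `0` and `1` and reduction modulo a maximal ideal of `R[X]`.
  have hmap : ∀ {S : Type _} [CommRing S] (φ : R[X] →+* S) (M N : Matrix (Fin n) (Fin n) R),
      φ ((T * ι M + ι N).det) =
        ((Matrix.scalar (Fin n) (φ X) - (φ.comp C).mapMatrix A) * (φ.comp C).mapMatrix M +
          (φ.comp C).mapMatrix N).det := by
    intro S _ φ M N
    have hι : ∀ M, φ.mapMatrix (ι M) = (φ.comp C).mapMatrix M := fun M => rfl
    have hs : φ.mapMatrix (Matrix.scalar (Fin n) (X : R[X])) = Matrix.scalar (Fin n) (φ X) := by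
      ext i j
      simp [Matrix.diagonal_apply, apply_ite φ]
    rw [RingHom.map_det, map_add, map_mul, map_sub, hι, hι, hι, hs]
  have hev : ∀ (c : R) (M N : Matrix (Fin n) (Fin n) R),
      (T * ι M + ι N).det.eval c = ((Matrix.scalar (Fin n) c - A) * M + N).det := by
    intro c M N
    have := hmap (evalRingHom c) M N
    have hid : (evalRingHom c).comp C = RingHom.id R := by ext; simp
    rw [hid] at this
    simpa using this
  refine ⟨(T * ι (1 - E) + ι E).det, (T * ι E + ι (1 - E)).det, ?_, ?_, ?_, ?_⟩
  -- The two matrices multiply to `T`, whose determinant is the characteristic polynomial.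
  · rw [← Matrix.det_mul, ← charpoly_companionMatrix hn hmonic hdeg, Matrix.charpoly]
    congr 1
    rw [map_sub, map_one]
    change T = _
    have h1 : ι E * (T * ι E) = T * ι E := by rw [← mul_assoc, ← hTE, mul_assoc, hιE]
    simp only [mul_add, add_mul, mul_sub, sub_mul, mul_one, mul_assoc, hιE, h1]
    abel
  · rw [hev, ← Matrix.isUnit_iff_isUnit_det]
    have hF : (Matrix.scalar (Fin n) (0 : R) - A) * (1 - E) + E =
        -W * (1 - E) + (1 - (1 - E)) := by
      rw [hA, map_zero]
      linear_combination (norm := noncomm_ring) hEE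
    rw [hF]
    refine isUnit_mul_add_one_sub (V := -V) hE.one_sub.eq ?_ ?_ ?_ ?_
    · linear_combination (norm := noncomm_ring) hEW
    · linear_combination (norm := noncomm_ring) hEV
    · rw [neg_mul_neg, hWV]
    · rw [neg_mul_neg, hVW]
  · rw [hev, ← Matrix.isUnit_iff_isUnit_det]
    have hF : (Matrix.scalar (Fin n) (1 : R) - A) * E + (1 - E) = -W * E + (1 - E) := by
      rw [hA, map_one]
      linear_combination (norm := noncomm_ring) -hEE
    rw [hF]
    refine isUnit_mul_add_one_sub (V := -V) hEE ?_ ?_ ?_ ?_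
    · linear_combination (norm := noncomm_ring) -hEW
    · linear_combination (norm := noncomm_ring) -hEV
    · rw [neg_mul_neg, hWV]
    · rw [neg_mul_neg, hVW]
  · by_contra hne
    obtain ⟨M, hM, hle⟩ := Ideal.exists_le_maximal _ hne
    let := Ideal.Quotient.field M
    let φ := Ideal.Quotient.mk M
    have h₀ : φ (T * ι (1 - E) + ι E).det = 0 :=
      Ideal.Quotient.eq_zero_iff_mem.2 (hle (Ideal.subset_span (by simp)))
    have h₁ : φ (T * ι E + ι (1 - E)).det = 0 :=
      Ideal.Quotient.eq_zero_iff_mem.2 (hle (Ideal.subset_span (by simp)))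
    rw [hmap, map_sub, map_one] at h₀ h₁
    refine (det_ne_zero_or_det_ne_zero hn (φ.comp C) (A := (φ.comp C).mapMatrix A) rfl ?_ ?_
      (φ X)).elim (absurd h₀) (absurd h₁)
    · rw [IsIdempotentElem, ← map_mul, hEE]
    · rw [← map_mul, ← map_mul, hcomm]

end Companion

end PierceClean

theorem mainTheorem5 {R : Type u} [CommRing R]
    (hR : ∀ x : PierceClean.PierceSpectrum R,
      PierceClean.IsProjectiveFree (PierceClean.PierceStalk x))
    (n : ℕ) (hn : 2 ≤ n) (h : R[X]) (hmonic : h.Monic) (hdeg : h.natDegree = n) :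
    List.TFAE [
      ∀ A : Matrix (Fin n) (Fin n) R, A.charpoly = h → PierceClean.IsStronglyClean A,
      PierceClean.IsStronglyClean (PierceClean.companionMatrix n h),
      PierceClean.HasGSRCFactorization h] := by
  have hn₀ : 0 < n := by omega
  have : Nontrivial R := by
    by_contra hR₀
    rw [not_nontrivial_iff_subsingleton] at hR₀
    rw [Subsingleton.elim h 0, Polynomial.natDegree_zero] at hdeg
    omega
  tfae_have 1 → 2 := fun H => H _ (PierceClean.charpoly_companionMatrix hn₀ hmonic hdeg)
  tfae_have 2 → 3 := fun H =>
    (PierceClean.hasSRCFactorization_of_isStronglyClean hn₀ hmonic hdeg H).hasGSRCFactorization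
  tfae_have 3 → 1 := fun H A hA =>
    H.hasSRCFactorization.isStronglyClean (hA ▸ Matrix.aeval_self_charpoly A)
  tfae_finish
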